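/- Let $\mathbb N$ be the set of positive integers. For $A\subset\mathbb N$ let $IP(A)\subset\mathbb Z$ be the set of sums of finite subsets of $A$ (including the empty sum $0$), and let $SIP(A)=IP(A)-IP(A)$. A set $B\subset\mathbb N$ is an SIP set if $SIP(A)\cap\mathbb N\subset B$ for some infinite $A\subset\mathbb N$; let $\mathcal S$ be the family of SIP sets. For a collection $\mathcal F$ of subsets of $\mathbb N$, write $(A+n)_+=(A+n)\cap\mathbb N$ and put $$\mathcal F^*=\{B\subset\mathbb N: B\cap A\neq\emptyset \text{ for all } A\in\mathcal F\},\qquad \mathcal F^{\#}=\{A\subset\mathbb N: A\cap B\in\mathcal F\text{ for all }B\in\mathcal F\},$$ $$\gamma\mathcal F=\{(A+n)_+: A\in\mathcal F,\ n\in\mathbb Z\},\qquad \tilde\gamma\mathcal F=\{A\subset\mathbb N: (A+n)_+\in\mathcal F\text{ for all } n\in\mathbb Z\}.$$ For a homeomorphism $T$ of a compact metric space $X$ and $U,V\subset X$, let $N(U,V)=\{n\in\mathbb N: T^n(U)\cap V\neq\emptyset\}$. The system $(X,T)$ is mild mixing if $N(U,V)\in\mathcal S^*$ for all nonempty open $U,V\subset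 X$. Let $\mathcal M$ be the family of all $B\subset\mathbb N$ such that $N(U,V)\subset B$ for some mild mixing system $(X,T)$ and some nonempty open $U,V\subset X$. Theorem. $\mathcal M\subset(\gamma\mathcal S)^{\#}=(\tilde\gamma(\mathcal S^*))^{\#}$. In particular, if $(X,T)$ is mild mixing, $U,V\subset X$ are nonempty and open, and $A\in\gamma\mathcal S$ (that is, $A$ is a translate of an SIP set), then $N(U,V)\cap A\in\gamma\mathcal S$. -/

import Mathlib

universe u

/-! The set of positive integers is `ℕ+`; integers are `ℤ`. -/

/-- The difference set `D(A) = A - A`. -/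
def diffSet (A : Set ℤ) : Set ℤ :=
  {d | ∃ a₁ ∈ A, ∃ a₂ ∈ A, d = a₁ - a₂}

/-- `IP(A)`: the sums of all finite subsets of `A` (the empty sum `0` included). -/
def IPSums (A : Set ℤ) : Set ℤ :=
  {s | ∃ F : Finset ℤ, (F : Set ℤ) ⊆ A ∧ s = ∑ a ∈ F, a}

/-- `SIP(A) = D(IP(A))`. -/
def SIPSums (A : Set ℤ) : Set ℤ :=
  diffSet (IPSums A)

/-- The positive part of a set of integers, as a set of positive integers. -/
def posPartSet (A : Set ℤ) : Set ℕ+ :=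
  {n | ((n : ℕ) : ℤ) ∈ A}

/-- A set of positive integers, regarded as a set of integers. -/
def toIntSet (A : Set ℕ+) : Set ℤ :=
  (fun n : ℕ+ => ((n : ℕ) : ℤ)) '' A

/-- The family `𝒮` of SIP sets: the sets of positive integers that contain
`SIP(A)₊` for some infinite set `A` of positive integers. -/
def sipFamily : Set (Set ℕ+) :=
  {B | ∃ A : Set ℕ+, A.Infinite ∧ posPartSet (SIPSums (toIntSet A)) ⊆ B}

/-- The family generated by a collection of subsets of `Q`. -/
def generatedFamily {Q : Type*} (F : Set (Set Q)) : Set (Set Q) :=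
  {B | ∃ A ∈ F, A ⊆ B}

/-- The dual family: the sets which meet every member of `F`. -/
def dualFamily {Q : Type*} (F : Set (Set Q)) : Set (Set Q) :=
  {B | ∀ A ∈ F, (B ∩ A).Nonempty}

/-- The sharp dual: the sets whose intersection with each member of `F` is again in `F`. -/
def sharpDual {Q : Type*} (F : Set (Set Q)) : Set (Set Q) :=
  {A | ∀ B ∈ F, A ∩ B ∈ F}

/-- The translate `(A + n)₊ = (A + n) ∩ ℕ+` for an integer `n`. -/
def translatePos (A : Set ℕ+) (n : ℤ) : Set ℕ+ :=
  posPartSet {m | ∃ a ∈ toIntSet A, m = a + n}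

/-- `γ F`: all translates of members of `F`. -/
def gammaFamily (F : Set (Set ℕ+)) : Set (Set ℕ+) :=
  {B | ∃ A ∈ F, ∃ n : ℤ, B = translatePos A n}

/-- `γ̃ F`: the sets all of whose translates are in `F`. -/
def gammaTilde (F : Set (Set ℕ+)) : Set (Set ℕ+) :=
  {A | ∀ n : ℤ, translatePos A n ∈ F}

/-- The hitting time set `N(U, V)` of positive `n` such that `T ^ n (U)` meets `V`. -/
def hittingTimes {X : Type*} [TopologicalSpace X] (T : X ≃ₜ X) (U V : Set X) : Set ℕ+ :=
  {n | ((⇑T)^[(n : ℕ)] '' U ∩ V).Nonempty}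

/-- `F` topological transitivity: `N(U, V) ∈ F` for all nonempty open `U`, `V`. -/
def FamilyTransitive {X : Type*} [TopologicalSpace X] (F : Set (Set ℕ+)) (T : X ≃ₜ X) : Prop :=
  ∀ U V : Set X, IsOpen U → U.Nonempty → IsOpen V → V.Nonempty → hittingTimes T U V ∈ F

/-- Mild mixing is `𝒮*` topological transitivity. -/
def MildMixing {X : Type*} [TopologicalSpace X] (T : X ≃ₜ X) : Prop :=
  FamilyTransitive (dualFamily sipFamily) T

/-- The family `ℳ` generated by the hitting time sets `N(U, V)` of all mild mixing
homeomorphisms of compact metric spaces, for nonempty open `U`, `V`. -/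
def mildMixingFamily : Set (Set ℕ+) :=
  generatedFamily {B | ∃ (X : Type u) (_ : MetricSpace X) (_ : CompactSpace X) (T : X ≃ₜ X)
    (U V : Set X), MildMixing T ∧ IsOpen U ∧ U.Nonempty ∧ IsOpen V ∧ V.Nonempty ∧
      B = hittingTimes T U V}

/-!
The equality of the two sharp duals is formal. Translating by `n` and by `-n` shows that
`γ̃(𝒮*) = (γ𝒮)*` (`gammaTilde_dualFamily`), and an upward closed family, being its own double dual,
has the same sharp dual as its dual (`sharpDual_dualFamily`). That `γ𝒮` is upward closed
(`gammaFamily_sipFamily_mono`) needs a small argument, since a right translate misses an initial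
segment: if `a ∈ A` and `A'` is a sparse part of `A` avoiding `a`, then `SIP(A')₊ - a ⊆ SIP(A)₊`, so
one may pass to left translates.

For the inclusion `ℳ ⊆ (γ𝒮)^#`, let `A` be infinite and replace `V` by `T⁻ⁿ V` to reduce to
intersecting `N(U, V)` with `SIP(A)`. Mild mixing gives `k ∈ N(U, V) ∩ SIP(A)`. Put
`U₀ = U ∩ T⁻ᵏ V` and let `A₀` be what remains of `A` after deleting the elements used to write `k`;
then `k + N(U₀, U₀) ⊆ N(U, V)` and `k + SIP(A₀) ⊆ SIP(A)`. Repeating this with the return times of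
the shrinking open sets, choose `bᵢ ∈ N(Uᵢ, Uᵢ) ∩ SIP(Aᵢ)`, put `Uᵢ₊₁ = Uᵢ ∩ T^(-bᵢ) Uᵢ`, and delete
from `Aᵢ` the elements used by `bᵢ`. A point of `Uₘ` is carried into `U₀` by every finite sum of
`b₀, …, bₘ₋₁`, so differences of such sums are return times of `U₀`; they lie in `SIP(A₀)` because
the `bᵢ` use disjoint parts of `A₀`. Hence `k + SIP({bᵢ})₊ ⊆ N(U, V) ∩ SIP(A)`
(`MildMixing.exists_SIPSums_subset`, `MildMixing.hittingTimes_inter_mem`). Thinning out each `Aᵢ` so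
that its positive signed sums exceed the previous choice makes the `bᵢ` distinct.
-/

/-! ### Finite signed sums -/

theorem toIntSet_mono {A B : Set ℕ+} (h : A ⊆ B) : toIntSet A ⊆ toIntSet B :=
  Set.image_mono h

theorem SIPSums_mono {A B : Set ℤ} (h : A ⊆ B) : SIPSums A ⊆ SIPSums B := by
  rintro d ⟨s, ⟨F, hF, rfl⟩, t, ⟨G, hG, rfl⟩, rfl⟩
  exact ⟨_, ⟨F, hF.trans h, rfl⟩, _, ⟨G, hG.trans h, rfl⟩, rfl⟩

theorem zero_mem_SIPSums (A : Set ℤ) : (0 : ℤ) ∈ SIPSums A :=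
  ⟨0, ⟨∅, by simp, by simp⟩, 0, ⟨∅, by simp, by simp⟩, by simp⟩

theorem mem_SIPSums_of_mem {A : Set ℤ} {a : ℤ} (ha : a ∈ A) : a ∈ SIPSums A :=
  ⟨a, ⟨{a}, by simpa using ha, by simp⟩, 0, ⟨∅, by simp, by simp⟩, by simp⟩

/-- An element `d` of `SIP(A)` involves only finitely many elements of `A`; away from these,
both `d` and `-d` can be added without leaving `SIP(A)`. -/
theorem exists_finset_add_mem_SIPSums {A : Set ℤ} {d : ℤ} (hd : d ∈ SIPSums A) :
    ∃ H : Finset ℤ, ∀ e ∈ SIPSums (A \ H), d + e ∈ SIPSums A ∧ -d + e ∈ SIPSums A := by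
  classical
  obtain ⟨_, ⟨F, hF, rfl⟩, _, ⟨G, hG, rfl⟩, rfl⟩ := hd
  refine ⟨F ∪ G, ?_⟩
  rintro _ ⟨_, ⟨P, hP, rfl⟩, _, ⟨Q, hQ, rfl⟩, rfl⟩
  have key : ∀ {K L : Finset ℤ}, (K : Set ℤ) ⊆ A → K ⊆ F ∪ G →
      (L : Set ℤ) ⊆ A \ ((F ∪ G : Finset ℤ) : Set ℤ) →
      ∑ a ∈ K, a + ∑ a ∈ L, a ∈ IPSums A := by
    intro K L hK hKs hL
    refine ⟨K ∪ L, ?_, (Finset.sum_union ?_).symm⟩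
    · rw [Finset.coe_union]
      exact Set.union_subset hK (hL.trans Set.sdiff_subset)
    · exact Finset.disjoint_left.2 fun x hx hxL => (hL hxL).2 (hKs hx)
  exact ⟨⟨_, key hF Finset.subset_union_left hP, _, key hG Finset.subset_union_right hQ, by ring⟩,
    ⟨_, key hG Finset.subset_union_right hP, _, key hF Finset.subset_union_left hQ, by ring⟩⟩

/-- The elements of `IP(A)`, for an enumerated set `A`, as sums with coefficients `0` and `1`. The
bound on the length may be increased, so that several sums can be given the same length. -/
theorem exists_coeff_of_mem_IPSums {f : ℕ → ℕ+} (hf : Function.Injective f) {s : ℤ}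
    (hs : s ∈ IPSums (toIntSet (Set.range f))) :
    ∃ (m₀ : ℕ) (ε : ℕ → ℕ), (∀ i, ε i = 0 ∨ ε i = 1) ∧
      ∀ m ≥ m₀, s = ((∑ i ∈ Finset.range m, ε i * (f i : ℕ) : ℕ) : ℤ) := by
  classical
  obtain ⟨F, hF, rfl⟩ := hs
  set g : ℕ → ℤ := fun i => ((f i : ℕ) : ℤ) with hg
  have hginj : Function.Injective g := fun i j h => hf (by simpa [hg] using h)
  have hFg : (F : Set ℤ) ⊆ Set.range g := by
    intro x hx
    obtain ⟨_, ⟨i, rfl⟩, hi⟩ := hF hx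
    exact ⟨i, hi⟩
  set I : Finset ℕ := F.preimage g hginj.injOn with hI
  have hsum : ∑ i ∈ I, g i = ∑ a ∈ F, a :=
    Finset.sum_preimage g F hginj.injOn (fun a => a) fun x hx hxn => absurd (hFg hx) hxn
  obtain ⟨m₀, hm₀⟩ := I.exists_nat_subset_range
  refine ⟨m₀, fun i => if i ∈ I then 1 else 0, fun i => ?_, fun m hm => ?_⟩
  · by_cases h : i ∈ I <;> simp [h]
  · have hIm : I ⊆ Finset.range m := hm₀.trans (Finset.range_mono hm)
    rw [← hsum, ← Finset.sum_subset hIm (f := fun i => (if i ∈ I then 1 else 0) * (f i : ℕ))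
      fun i _ hi => by simp [hi], Nat.cast_sum]
    exact Finset.sum_congr rfl fun i hi => by simp [hi, hg]

theorem exists_coeff_of_mem_SIPSums {f : ℕ → ℕ+} (hf : Function.Injective f) {d : ℤ}
    (hd : d ∈ SIPSums (toIntSet (Set.range f))) :
    ∃ (m : ℕ) (ε δ : ℕ → ℕ), (∀ i, ε i = 0 ∨ ε i = 1) ∧ (∀ i, δ i = 0 ∨ δ i = 1) ∧
      d = ((∑ i ∈ Finset.range m, ε i * (f i : ℕ) : ℕ) : ℤ) -
        ((∑ i ∈ Finset.range m, δ i * (f i : ℕ) : ℕ) : ℤ) := by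
  obtain ⟨s, hs, t, ht, rfl⟩ := hd
  obtain ⟨m, ε, hε, h₁⟩ := exists_coeff_of_mem_IPSums hf hs
  obtain ⟨n, δ, hδ, h₂⟩ := exists_coeff_of_mem_IPSums hf ht
  exact ⟨max m n, ε, δ, hε, hδ, by rw [← h₁ _ (le_max_left _ _), ← h₂ _ (le_max_right _ _)]⟩

/-- An infinite set `A` has an infinite subset all of whose positive signed sums exceed a given
bound: a sufficiently lacunary subset will do, since the last term of a signed sum dominates. -/
theorem exists_infinite_subset_lt_of_mem_SIPSums {A : Set ℕ+} (hA : A.Infinite) (N : ℕ) :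
    ∃ B ⊆ A, B.Infinite ∧ ∀ d ∈ SIPSums (toIntSet B), 0 < d → (N : ℤ) < d := by
  obtain ⟨f, hfA, hf2⟩ := exists_seq_of_forall_finset_exists
    (fun a : ℕ+ => a ∈ A ∧ N < (a : ℕ)) (fun a b => 2 * (a : ℕ) < (b : ℕ)) (by
      intro s _
      obtain ⟨a, haA, ha⟩ := hA.exists_gt (⟨N + 1 + ∑ x ∈ s, 2 * (x : ℕ), by omega⟩ : ℕ+)
      have ha' : N + 1 + ∑ x ∈ s, 2 * (x : ℕ) < (a : ℕ) := ha
      refine ⟨a, ⟨haA, by omega⟩, fun x hx => ?_⟩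
      have := Finset.single_le_sum (f := fun x : ℕ+ => 2 * (x : ℕ)) (fun _ _ => Nat.zero_le _) hx
      omega)
  have hmono : StrictMono f := fun i j hij => by
    have := hf2 i j hij
    exact PNat.coe_lt_coe _ _ |>.1 (by omega)
  have hsum : ∀ n, N + ∑ i ∈ Finset.range n, (f i : ℕ) < f n := by
    intro n
    induction n with
    | zero => simpa using (hfA 0).2
    | succ n ih =>
      rw [Finset.sum_range_succ]
      have := hf2 n (n + 1) n.lt_succ_self
      omega
  refine ⟨Set.range f, by rintro _ ⟨i, rfl⟩; exact (hfA i).1,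
    Set.infinite_range_of_injective hmono.injective, fun d hd hpos => ?_⟩
  obtain ⟨m, ε, δ, hε, hδ, rfl⟩ := exists_coeff_of_mem_SIPSums hmono.injective hd
  clear hd
  have hle : ∀ (ε : ℕ → ℕ), (∀ i, ε i = 0 ∨ ε i = 1) → ∀ n,
      ∑ i ∈ Finset.range n, ε i * (f i : ℕ) ≤ ∑ i ∈ Finset.range n, (f i : ℕ) := by
    intro ε hε n
    refine Finset.sum_le_sum fun i _ => ?_
    rcases hε i with h | h <;> simp [h]
  induction m with
  | zero => simp at hpos
  | succ m ih =>
    have h₁ := hsum m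
    have h₂ := hle ε hε m
    have h₃ := hle δ hδ m
    simp only [Finset.sum_range_succ] at ih hpos ⊢
    generalize ∑ i ∈ Finset.range m, ε i * (f i : ℕ) = s at *
    generalize ∑ i ∈ Finset.range m, δ i * (f i : ℕ) = t at *
    rcases hε m with h | h <;> rcases hδ m with h' | h' <;>
      simp only [h, h', zero_mul, one_mul, add_zero] at hpos ⊢ <;> omega

theorem exists_infinite_toIntSet_subset_sdiff {A : Set ℕ+} (hA : A.Infinite) (H : Finset ℤ) :
    ∃ B : Set ℕ+, B.Infinite ∧ toIntSet B ⊆ toIntSet A \ H := by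
  refine ⟨A \ ((fun n : ℕ+ => ((n : ℕ) : ℤ)) ⁻¹' H), hA.sdiff (H.finite_toSet.preimage ?_), ?_⟩
  · intro a _ b _ h
    simpa using h
  · rintro _ ⟨a, ha, rfl⟩
    exact ⟨⟨a, ha.1, rfl⟩, ha.2⟩

/-- The tail of an infinite set after an element `d` of `SIP(A)` has been used up, thinned out so
that its positive signed sums exceed `N`. -/
theorem exists_infinite_tail {A : Set ℕ+} (hA : A.Infinite) {d : ℤ}
    (hd : d ∈ SIPSums (toIntSet A)) (N : ℕ) :
    ∃ B : Set ℕ+, B.Infinite ∧ (∀ e ∈ SIPSums (toIntSet B), e ∈ SIPSums (toIntSet A) ∧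
      d + e ∈ SIPSums (toIntSet A) ∧ -d + e ∈ SIPSums (toIntSet A)) ∧
      ∀ e ∈ SIPSums (toIntSet B), 0 < e → (N : ℤ) < e := by
  obtain ⟨H, hH⟩ := exists_finset_add_mem_SIPSums hd
  obtain ⟨C, hC, hCA⟩ := exists_infinite_toIntSet_subset_sdiff hA H
  obtain ⟨B, hBC, hB, hBN⟩ := exists_infinite_subset_lt_of_mem_SIPSums hC N
  have hBA : toIntSet B ⊆ toIntSet A \ H := (toIntSet_mono hBC).trans hCA
  exact ⟨B, hB, fun e he => ⟨SIPSums_mono (hBA.trans Set.sdiff_subset) he,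
    hH e (SIPSums_mono hBA he)⟩, hBN⟩

/-! ### Translates, duals and sharp duals of families -/

theorem mem_translatePos {A : Set ℕ+} {n : ℤ} {m : ℕ+} :
    m ∈ translatePos A n ↔ ∃ a ∈ A, ((m : ℕ) : ℤ) = ((a : ℕ) : ℤ) + n := by
  simp [translatePos, posPartSet, toIntSet]

/-- Membership in `γ𝒮` only asks for the inclusion of a translate of `SIP(A)₊`. A translate by
`n > 0` of a member of `𝒮` misses the numbers up to `n`; the symmetry of `SIP(A)` allows replacing
it by a translate to the left. -/
theorem mem_gammaFamily_sipFamily_iff {C : Set ℕ+} :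
    C ∈ gammaFamily sipFamily ↔ ∃ A : Set ℕ+, A.Infinite ∧ ∃ n : ℤ,
      ∀ m : ℕ+, ((m : ℕ) : ℤ) - n ∈ SIPSums (toIntSet A) → 0 < ((m : ℕ) : ℤ) - n → m ∈ C := by
  constructor
  · rintro ⟨S, ⟨A, hA, hAS⟩, n, rfl⟩
    refine ⟨A, hA, n, fun m hm hpos => mem_translatePos.2 ?_⟩
    obtain ⟨a, ha⟩ : ∃ a : ℕ+, ((a : ℕ) : ℤ) = ((m : ℕ) : ℤ) - n :=
      ⟨⟨(((m : ℕ) : ℤ) - n).toNat, by omega⟩, Int.toNat_of_nonneg hpos.le⟩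
    exact ⟨a, hAS (show ((a : ℕ) : ℤ) ∈ SIPSums _ by rwa [ha]), by rw [ha]; ring⟩
  · rintro ⟨A, hA, n, hC⟩
    -- Shift by an element `a ≥ n` of `A`, so that the remaining translation `n - a` is not positive.
    obtain ⟨a, haA, han⟩ := hA.exists_gt (⟨n.toNat + 1, by omega⟩ : ℕ+)
    have han' : n.toNat + 1 < (a : ℕ) := han
    obtain ⟨B, hB, hBA, hBa⟩ := exists_infinite_tail hA
      (mem_SIPSums_of_mem (A := toIntSet A) ⟨a, haA, rfl⟩) a
    refine ⟨{m | ∀ c : ℕ+, ((c : ℕ) : ℤ) = ((m : ℕ) : ℤ) + (n - (a : ℕ)) → c ∈ C},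
      ⟨B, hB, fun m hm c hc => hC c ?_ ?_⟩, n - (a : ℕ), ?_⟩
    · have := (hBA _ hm).2.2
      rwa [show ((c : ℕ) : ℤ) - n = -((a : ℕ) : ℤ) + ((m : ℕ) : ℤ) by rw [hc]; ring]
    · have := hBa _ hm (by exact_mod_cast m.pos)
      omega
    · ext c
      rw [mem_translatePos]
      constructor
      · intro hc
        have hcpos := c.pos
        refine ⟨⟨(((c : ℕ) : ℤ) - (n - (a : ℕ))).toNat, by omega⟩, fun c' hc' => ?_, ?_⟩
        · have : c' = c := PNat.eq (by simp only [PNat.mk_coe] at hc'; omega)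
          rwa [this]
        · simp only [PNat.mk_coe]; omega
      · rintro ⟨m, hm, hcm⟩
        exact hm c hcm

theorem gammaFamily_sipFamily_mono {B C : Set ℕ+} (hB : B ∈ gammaFamily sipFamily) (h : B ⊆ C) :
    C ∈ gammaFamily sipFamily := by
  obtain ⟨A, hA, n, hn⟩ := mem_gammaFamily_sipFamily_iff.1 hB
  exact mem_gammaFamily_sipFamily_iff.2 ⟨A, hA, n, fun m h₁ h₂ => h (hn m h₁ h₂)⟩

theorem gammaTilde_dualFamily (F : Set (Set ℕ+)) :
    gammaTilde (dualFamily F) = dualFamily (gammaFamily F) := by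
  ext B
  constructor
  · rintro hB _ ⟨A, hA, n, rfl⟩
    obtain ⟨a, haB, haA⟩ := hB (-n) A hA
    obtain ⟨b, hb, hab⟩ := mem_translatePos.1 haB
    exact ⟨b, hb, mem_translatePos.2 ⟨a, haA, by omega⟩⟩
  · intro hB n A hA
    obtain ⟨b, hbB, hb⟩ := hB _ ⟨A, hA, -n, rfl⟩
    obtain ⟨a, haA, hab⟩ := mem_translatePos.1 hb
    exact ⟨a, mem_translatePos.2 ⟨b, hbB, by omega⟩, haA⟩

/-- A family and its dual have the same sharp dual, because an upward closed family is its own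
double dual. -/
theorem sharpDual_dualFamily {Q : Type*} {F : Set (Set Q)}
    (hF : ∀ B ∈ F, ∀ C, B ⊆ C → C ∈ F) : sharpDual (dualFamily F) = sharpDual F := by
  ext A
  constructor
  · intro hA B hB
    by_contra hAB
    have hdual : (A ∩ B)ᶜ ∈ dualFamily F := by
      intro C hC
      by_contra hne
      exact hAB (hF C hC _ fun x hx => by_contra fun hx' => hne ⟨x, hx', hx⟩)
    obtain ⟨x, ⟨hxA, hx⟩, hxB⟩ := hA _ hdual B hB
    exact hx ⟨hxA, hxB⟩
  · intro hA B hB C hC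
    obtain ⟨x, hxB, hxA, hxC⟩ := hB _ (hA C hC)
    exact ⟨x, ⟨hxA, hxB⟩, hxC⟩

/-! ### Hitting times in mild mixing systems -/

section Dynamics

variable {X : Type*} [TopologicalSpace X] {T : X ≃ₜ X}

theorem coe_zpow_natCast (T : X ≃ₜ X) (n : ℕ) : ⇑(T ^ (n : ℤ)) = (⇑T)^[n] := by
  rw [zpow_natCast]
  induction n with
  | zero => rfl
  | succ n ih =>
    rw [pow_succ, Function.iterate_succ, ← ih]
    rfl

theorem mem_hittingTimes {U V : Set X} {n : ℕ+} :
    n ∈ hittingTimes T U V ↔ ∃ x ∈ U, (T ^ ((n : ℕ) : ℤ)) x ∈ V := by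
  rw [coe_zpow_natCast]
  constructor
  · rintro ⟨_, ⟨x, hx, rfl⟩, hV⟩
    exact ⟨x, hx, hV⟩
  · rintro ⟨x, hx, hV⟩
    exact ⟨_, ⟨x, hx, rfl⟩, hV⟩

theorem zpow_add_apply (T : X ≃ₜ X) (m n : ℤ) (x : X) :
    (T ^ (m + n)) x = (T ^ m) ((T ^ n) x) := by
  rw [zpow_add]
  rfl

/-- In a mild mixing system, `N(U, V)` meets `SIP(A)`; moreover `U` and `A` can be shrunk so that
the hitting time and all later signed sums are compatible. -/
theorem MildMixing.exists_step (hT : MildMixing T) {U V : Set X} (hU : IsOpen U)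
    (hUne : U.Nonempty) (hV : IsOpen V) (hVne : V.Nonempty) {A : Set ℕ+} (hA : A.Infinite) :
    ∃ (b : ℕ+) (B : Set ℕ+) (W : Set X), B.Infinite ∧ IsOpen W ∧ W.Nonempty ∧
      (∀ e ∈ SIPSums (toIntSet B), e ∈ SIPSums (toIntSet A) ∧
        ((b : ℕ) : ℤ) + e ∈ SIPSums (toIntSet A) ∧ -((b : ℕ) : ℤ) + e ∈ SIPSums (toIntSet A)) ∧
      (∀ e ∈ SIPSums (toIntSet B), 0 < e → ((b : ℕ) : ℤ) < e) ∧
      W ⊆ U ∧ ∀ x ∈ W, (T ^ ((b : ℕ) : ℤ)) x ∈ V := by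
  obtain ⟨b, hbN, hbA⟩ := hT U V hU hUne hV hVne _ ⟨A, hA, subset_rfl⟩
  obtain ⟨x, hxU, hxV⟩ := mem_hittingTimes.1 hbN
  obtain ⟨B, hB, hBA, hBb⟩ := exists_infinite_tail hA (d := ((b : ℕ) : ℤ)) hbA b
  exact ⟨b, B, U ∩ (T ^ ((b : ℕ) : ℤ)) ⁻¹' V, hB, hU.inter (hV.preimage (Homeomorph.continuous _)),
    ⟨x, hxU, hxV⟩, hBA, hBb, Set.inter_subset_left, fun y hy => hy.2⟩

/-- In a mild mixing system, the return times `N(U, U)` and `SIP(A)` have a common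
`SIP(B)₊`. -/
theorem MildMixing.exists_SIPSums_subset (hT : MildMixing T) {U : Set X} (hU : IsOpen U)
    (hUne : U.Nonempty) {A : Set ℕ+} (hA : A.Infinite) :
    ∃ B : Set ℕ+, B.Infinite ∧ ∀ d ∈ SIPSums (toIntSet B), d ∈ SIPSums (toIntSet A) ∧
      ∃ x ∈ U, (T ^ d) x ∈ U := by
  let σ := {p : Set ℕ+ × Set X // p.1.Infinite ∧ IsOpen p.2 ∧ p.2.Nonempty}
  have step : ∀ p : σ, ∃ (b : ℕ+) (q : σ),
      (∀ e ∈ SIPSums (toIntSet q.1.1), e ∈ SIPSums (toIntSet p.1.1) ∧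
        ((b : ℕ) : ℤ) + e ∈ SIPSums (toIntSet p.1.1) ∧
        -((b : ℕ) : ℤ) + e ∈ SIPSums (toIntSet p.1.1)) ∧
      (∀ e ∈ SIPSums (toIntSet q.1.1), 0 < e → ((b : ℕ) : ℤ) < e) ∧
      q.1.2 ⊆ p.1.2 ∧ ∀ x ∈ q.1.2, (T ^ ((b : ℕ) : ℤ)) x ∈ p.1.2 := by
    rintro ⟨⟨C, W⟩, hC, hW, hWne⟩
    obtain ⟨b, B, W', hB, hW', hW'ne, h⟩ := hT.exists_step hW hWne hW hWne hC
    exact ⟨b, ⟨⟨B, W'⟩, hB, hW', hW'ne⟩, h⟩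
  choose β next hSIP hlt hsub hmap using step
  let p : ℕ → σ := fun n => next^[n] ⟨⟨A, U⟩, hA, hU, hUne⟩
  have hp : ∀ n, p (n + 1) = next (p n) := fun n => Function.iterate_succ_apply' next n _
  set b : ℕ → ℕ+ := fun n => β (p n) with hb
  have hbmem : ∀ n, ((b n : ℕ) : ℤ) ∈ SIPSums (toIntSet (p n).1.1) := fun n => by
    have := (hSIP (p n) 0 (zero_mem_SIPSums _)).2.1
    rwa [add_zero] at this
  have hmono : StrictMono b := strictMono_nat_of_lt_succ fun n => by
    have h := hbmem (n + 1)
    rw [hp] at h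
    have := hlt (p n) _ h (by exact_mod_cast (b (n + 1)).pos)
    exact_mod_cast this
  have hshift : ∀ (m j : ℕ) (ε : ℕ → ℕ), ∑ i ∈ Finset.range (m + 1), ε i * (b (j + i) : ℕ) =
      ∑ i ∈ Finset.range m, ε (i + 1) * (b (j + 1 + i) : ℕ) + ε 0 * (b j : ℕ) := by
    intro m j ε
    rw [Finset.sum_range_succ', add_zero]
    exact congrArg (· + _) (Finset.sum_congr rfl fun i _ => by rw [add_assoc j 1 i, add_comm 1 i])
  have hsums : ∀ (m j : ℕ) (ε δ : ℕ → ℕ), (∀ i, ε i = 0 ∨ ε i = 1) → (∀ i, δ i = 0 ∨ δ i = 1) →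
      ((∑ i ∈ Finset.range m, ε i * (b (j + i) : ℕ) : ℕ) : ℤ) -
        ((∑ i ∈ Finset.range m, δ i * (b (j + i) : ℕ) : ℕ) : ℤ) ∈
          SIPSums (toIntSet (p j).1.1) := by
    intro m
    induction m with
    | zero => intro j ε δ _ _; simpa using zero_mem_SIPSums _
    | succ m ih =>
      intro j ε δ hε hδ
      have h := ih (j + 1) (fun i => ε (i + 1)) (fun i => δ (i + 1)) (fun i => hε _) fun i => hδ _
      rw [hp] at h
      have h' := hSIP (p j) _ h
      rw [hshift, hshift]
      rcases hε 0 with h₁ | h₁ <;> rcases hδ 0 with h₂ | h₂ <;>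
        simp only [h₁, h₂, zero_mul, one_mul, add_zero]
      · exact h'.1
      · convert h'.2.2 using 1; push_cast; ring
      · convert h'.2.1 using 1; push_cast; ring
      · convert h'.1 using 1; push_cast; ring
  have hret : ∀ (m j : ℕ) (ε : ℕ → ℕ), (∀ i, ε i = 0 ∨ ε i = 1) → ∀ x ∈ (p (j + m)).1.2,
      (T ^ ((∑ i ∈ Finset.range m, ε i * (b (j + i) : ℕ) : ℕ) : ℤ)) x ∈ (p j).1.2 := by
    intro m
    induction m with
    | zero => intro j ε _ x hx; simpa using hx
    | succ m ih =>
      intro j ε hε x hx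
      have h := ih (j + 1) (fun i => ε (i + 1)) (fun i => hε _) x
        (by rwa [show j + 1 + m = j + (m + 1) by omega])
      rw [hp] at h
      rw [hshift]
      rcases hε 0 with h₁ | h₁ <;> simp only [h₁, zero_mul, one_mul, add_zero]
      · exact hsub _ h
      · rw [add_comm, Nat.cast_add, zpow_add_apply]
        exact hmap _ _ h
  refine ⟨Set.range b, Set.infinite_range_of_injective hmono.injective, fun d hd => ?_⟩
  obtain ⟨m, ε, δ, hε, hδ, rfl⟩ := exists_coeff_of_mem_SIPSums hmono.injective hd
  refine ⟨by simpa [p] using hsums m 0 ε δ hε hδ, ?_⟩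
  obtain ⟨x, hx⟩ := (p (0 + m)).2.2.2
  -- Both sums move `x` back into `U`, so their difference is a return time of `U`.
  refine ⟨_, hret m 0 δ hδ x hx, ?_⟩
  rw [← zpow_add_apply]
  simpa [p] using hret m 0 ε hε x hx

theorem MildMixing.hittingTimes_inter_mem (hT : MildMixing T) {U V : Set X} (hU : IsOpen U)
    (hUne : U.Nonempty) (hV : IsOpen V) (hVne : V.Nonempty) {A : Set ℕ+}
    (hA : A ∈ gammaFamily sipFamily) : hittingTimes T U V ∩ A ∈ gammaFamily sipFamily := by
  obtain ⟨C, hC, n, hCA⟩ := mem_gammaFamily_sipFamily_iff.1 hA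
  obtain ⟨k, D, W, hD, hW, hWne, hDC, -, hWU, hWV⟩ := hT.exists_step hU hUne
    (V := (T ^ n) ⁻¹' V) (hV.preimage (Homeomorph.continuous _))
    (hVne.preimage (T ^ n).surjective) hC
  obtain ⟨B, hB, hBD⟩ := hT.exists_SIPSums_subset hW hWne hD
  refine mem_gammaFamily_sipFamily_iff.2 ⟨B, hB, n + (k : ℕ), fun m hm hpos => ⟨?_, hCA m ?_ ?_⟩⟩
  · obtain ⟨x, hxW, hx⟩ := (hBD _ hm).2
    refine mem_hittingTimes.2 ⟨x, hWU hxW, ?_⟩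
    have h := hWV _ hx
    rw [Set.mem_preimage, ← zpow_add_apply, ← zpow_add_apply] at h
    convert h using 3
    ring
  · convert (hDC _ (hBD _ hm).1).2.1 using 1
    ring
  · omega

end Dynamics

theorem theorem502 :
    mildMixingFamily.{u} ⊆ sharpDual (gammaFamily sipFamily) ∧
    sharpDual (gammaFamily sipFamily) = sharpDual (gammaTilde (dualFamily sipFamily)) ∧
    (∀ (X : Type u) [MetricSpace X] [CompactSpace X] (T : X ≃ₜ X), MildMixing T →
      ∀ U V : Set X, IsOpen U → U.Nonempty → IsOpen V → V.Nonempty →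
        ∀ A ∈ gammaFamily sipFamily, hittingTimes T U V ∩ A ∈ gammaFamily sipFamily) := by
  have key : ∀ (X : Type u) [MetricSpace X] [CompactSpace X] (T : X ≃ₜ X), MildMixing T →
      ∀ U V : Set X, IsOpen U → U.Nonempty → IsOpen V → V.Nonempty →
        ∀ A ∈ gammaFamily sipFamily, hittingTimes T U V ∩ A ∈ gammaFamily sipFamily :=
    fun X _ _ T hT U V hU hUne hV hVne A hA => hT.hittingTimes_inter_mem hU hUne hV hVne hA
  refine ⟨?_, ?_, key⟩
  · rintro B ⟨_, ⟨X, _, _, T, U, V, hT, hU, hUne, hV, hVne, rfl⟩, hB⟩ A hA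
    exact gammaFamily_sipFamily_mono (key X T hT U V hU hUne hV hVne A hA)
      (Set.inter_subset_inter_left _ hB)
  · rw [gammaTilde_dualFamily, sharpDual_dualFamily fun B hB C h =>
      gammaFamily_sipFamily_mono hB h]
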